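/- Let $(\Omega,\mathcal F,P)$ be a probability space, $\mathcal B\subset\mathbb R^p$ compact, $\beta_0$ an interior point of $\mathcal B$, and let $Q_n(\beta)$, $n\ge 0$, $\beta\in\mathbb R^p$, be real-valued random objective functions ($Q_n$ is computed from the first $n$ data). Assume: (a) $Q_n$ is almost surely continuous on $\mathcal B$; almost surely $Q_n\to Q_\infty$ uniformly on $\mathcal B$ for a nonrandom function $Q_\infty$ with $Q_\infty(\beta)<Q_\infty(\beta_0)$ for all $\beta\in\mathcal B\setminus\{\beta_0\}$; (b) on some open neighbourhood $V$ of $\beta_0$, $Q_n$ is almost surely twice continuously differentiable, and almost surely the Hessians $A_n(\beta)=\partial^2Q_n(\beta)/\partial\beta\,\partial\beta^\top$ converge uniformly on $V$ to a nonrandom matrix function whose value $A$ at $\beta_0$ is nonsingular; (c) $\sqrt n\,\partial Q_n(\beta_0)/\partial\beta$ converges in distribution to $\mathsf N_p(0,B)$ for a positive semidefinite $B$. Let $g:\mathbb R^p\to\mathbb R^q$ be continuously differentiable with $g(\beta_0)=0$ (the null hypothesis $H_0$), such that the $q\times p$ matrix $G=\partial g(\beta_0)/\partial\beta^\top$ has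 rank $q$. Put $$S=G(-A)^{-1}G^\top,\quad \Omega=GA^{-1}BA^{-1}G^\top,\quad G^+=G^\top(GG^\top)^{-1},\quad P_G=G^+G,$$ and assume that $\Omega$ is nonsingular. Let $\widehat\beta_n$ be a maximizer of $Q_n$ over $\mathcal B$, and let $\widetilde\beta_n$ be a maximizer over $\{\beta\in\mathcal B:g(\beta)=0\}$ of the Lagrangian $L_n(\cdot,\widetilde\lambda_n)$, where $L_n(\beta,\lambda)=Q_n(\beta)-g(\beta)^\top\lambda$ (which equals $Q_n(\beta)$ on that set). Let $\widetilde\lambda_n$ be a Lagrange multiplier at $\widetilde\beta_n$, that is, a solution $\lambda$ of the first-order condition $\partial L_n(\widetilde\beta_n,\lambda)/\partial\beta=0$ whenever there is one. Let $\widehat\beta_n$, $\widetilde\beta_n$, $\widetilde\lambda_n$ and $s_n=\partial Q_n(\widetilde\beta_n)/\partial\beta$ be measurable. Then $$BF_1=n\widetilde\lambda_n^\top S\Omega^{-1}g(\widehat\beta_n),\quad BF_2=n\,s_n^\top G^+S\Omega^{-1}g(\widehat\beta_n),\quad BF_3=n\,s_n^\top G^+S\Omega^{-1}G(\widehat\beta_n-\widetilde\beta_n)$$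 all converge in distribution to $\chi^2_q$. If in addition $B=-A$, then $$BF_4=n\widetilde\lambda_n^\top g(\widehat\beta_n),\quad BF_5=n\,s_n^\top G^+g(\widehat\beta_n),\quad BF_6=n\,s_n^\top P_G(\widehat\beta_n-\widetilde\beta_n),\quad BF_7=n\,s_n^\top(\widehat\beta_n-\widetilde\beta_n)$$ all converge in distribution to $\chi^2_q$ as well. -/

import Mathlib

open MeasureTheory ProbabilityTheory Filter Topology Matrix

namespace ExtremumTest

noncomputable section

/-- `ℝ^d` with its Euclidean norm. -/
abbrev Vec (d : ℕ) := EuclideanSpace ℝ (Fin d)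

/-- The Jacobian matrix `∂g(β)/∂βᵀ`, whose `(i, j)` entry is `∂gᵢ(β)/∂βⱼ`. -/
def jacobian {p q : ℕ} (g : Vec p → Vec q) (β : Vec p) : Matrix (Fin q) (Fin p) ℝ :=
  Matrix.of fun i j => (fderiv ℝ g β (EuclideanSpace.single j 1)) i

/-- The Hessian matrix `∂²Q(β)/∂β∂βᵀ`. -/
def hessian {p : ℕ} (Q : Vec p → ℝ) (β : Vec p) : Matrix (Fin p) (Fin p) ℝ :=
  Matrix.of fun i j =>
    fderiv ℝ (fderiv ℝ Q) β (EuclideanSpace.single i 1) (EuclideanSpace.single j 1)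

/-- The gradient `∂Q(β)/∂β`. -/
def score {p : ℕ} (Q : Vec p → ℝ) (β : Vec p) : Vec p := gradient Q β

/-- The Lagrangian `L(β, lam) = Q(β) - g(β)ᵀ lam`. -/
def lagrangian {p q : ℕ} (Q : Vec p → ℝ) (g : Vec p → Vec q) (β : Vec p) (lam : Vec q) : ℝ :=
  Q β - (g β).ofLp ⬝ᵥ lam.ofLp

/-- `b` maximizes `Q` over the parameter set `Bset`. -/
def IsUnconstrainedEstimator {p : ℕ} (Q : Vec p → ℝ) (Bset : Set (Vec p)) (b : Vec p) : Prop :=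
  b ∈ Bset ∧ IsMaxOn Q Bset b

/-- `b` maximizes the Lagrangian `L(·, lam)` over `{β ∈ Bset : g(β) = 0}`. (On this set `L(·, lam)`
is `Q`, so the value of `lam` does not matter here.) -/
def IsConstrainedEstimator {p q : ℕ} (Q : Vec p → ℝ) (g : Vec p → Vec q) (Bset : Set (Vec p))
    (lam : Vec q) (b : Vec p) : Prop :=
  b ∈ {β ∈ Bset | g β = 0} ∧ IsMaxOn (fun β => lagrangian Q g β lam) {β ∈ Bset | g β = 0} b

/-- `lam` satisfies the first-order condition of the Lagrangian at `b`: `L(·, lam)` is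
differentiable at `b` with derivative `0`. -/
def SolvesFirstOrderCondition {p q : ℕ} (Q : Vec p → ℝ) (g : Vec p → Vec q)
    (b : Vec p) (lam : Vec q) : Prop :=
  HasFDerivAt (fun β => lagrangian Q g β lam) (0 : Vec p →L[ℝ] ℝ) b

/-- `lam` is a Lagrange multiplier of the constrained problem at `b`: it solves the first-order
condition whenever that equation has a solution. (If `b` is for instance on the boundary of the
parameter set, there may be no solution, and then nothing is required of `lam`.) -/
def IsLagrangeMultiplier {p q : ℕ} (Q : Vec p → ℝ) (g : Vec p → Vec q)
    (b : Vec p) (lam : Vec q) : Prop :=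
  (∃ l : Vec q, SolvesFirstOrderCondition Q g b l) → SolvesFirstOrderCondition Q g b lam

/-- The Moore-Penrose inverse `G⁺ = Gᵀ (G Gᵀ)⁻¹` of a matrix of full row rank. -/
def pinv {p q : ℕ} (G : Matrix (Fin q) (Fin p) ℝ) : Matrix (Fin p) (Fin q) ℝ :=
  Gᵀ * (G * Gᵀ)⁻¹

/-- `S = G (-A)⁻¹ Gᵀ`. -/
def matS {p q : ℕ} (G : Matrix (Fin q) (Fin p) ℝ) (A : Matrix (Fin p) (Fin p) ℝ) :
    Matrix (Fin q) (Fin q) ℝ :=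
  G * (-A)⁻¹ * Gᵀ

/-- `Ω = G A⁻¹ B A⁻¹ Gᵀ`. -/
def matOmega {p q : ℕ} (G : Matrix (Fin q) (Fin p) ℝ) (A B : Matrix (Fin p) (Fin p) ℝ) :
    Matrix (Fin q) (Fin q) ℝ :=
  G * A⁻¹ * B * A⁻¹ * Gᵀ

/-- `P_G = G⁺ G`. -/
def matP {p q : ℕ} (G : Matrix (Fin q) (Fin p) ℝ) : Matrix (Fin p) (Fin p) ℝ :=
  pinv G * G

/-! The seven bilinear form statistics. Here `ghat` is the restriction function at the unconstrained
estimator `bhat`, `stil` is the score at the constrained estimator `btil`, and `lam` is the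
Lagrange multiplier. -/

section statistics

variable {p q : ℕ} (n : ℕ) (G : Matrix (Fin q) (Fin p) ℝ) (A B : Matrix (Fin p) (Fin p) ℝ)
  (lam ghat : Vec q) (stil bhat btil : Vec p)

/-- `n lamᵀ S Ω⁻¹ g(bhat)` -/
def BF1 : ℝ := n * (lam.ofLp ⬝ᵥ ((matS G A * (matOmega G A B)⁻¹) *ᵥ ghat.ofLp))

/-- `n (∂Q(btil)/∂βᵀ) G⁺ S Ω⁻¹ g(bhat)` -/
def BF2 : ℝ := n * (stil.ofLp ⬝ᵥ ((pinv G * matS G A * (matOmega G A B)⁻¹) *ᵥ ghat.ofLp))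

/-- `n (∂Q(btil)/∂βᵀ) G⁺ S Ω⁻¹ G (bhat - btil)` -/
def BF3 : ℝ :=
  n * (stil.ofLp ⬝ᵥ ((pinv G * matS G A * (matOmega G A B)⁻¹ * G) *ᵥ (bhat - btil).ofLp))

/-- `n lamᵀ g(bhat)` -/
def BF4 : ℝ := n * (lam.ofLp ⬝ᵥ ghat.ofLp)

/-- `n (∂Q(btil)/∂βᵀ) G⁺ g(bhat)` -/
def BF5 : ℝ := n * (stil.ofLp ⬝ᵥ (pinv G *ᵥ ghat.ofLp))

/-- `n (∂Q(btil)/∂βᵀ) P_G (bhat - btil)` -/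
def BF6 : ℝ := n * (stil.ofLp ⬝ᵥ (matP G *ᵥ (bhat - btil).ofLp))

/-- `n (∂Q(btil)/∂βᵀ) (bhat - btil)` -/
def BF7 : ℝ := n * (stil.ofLp ⬝ᵥ (bhat - btil).ofLp)

end statistics

/-- The law of `q` independent standard normal variables. -/
def stdNormals (q : ℕ) : Measure (Fin q → ℝ) := Measure.pi fun _ => gaussianReal 0 1

instance (q : ℕ) : IsProbabilityMeasure (stdNormals q) := by
  unfold stdNormals; infer_instance

/-- The chi-square distribution with `q` degrees of freedom: the law of the sum of the squares of
`q` independent standard normal variables (the point mass at `0` for `q = 0`). -/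
def chiSquare (q : ℕ) : Measure ℝ := (stdNormals q).map fun x => ∑ i, x i ^ 2

instance (q : ℕ) : IsProbabilityMeasure (chiSquare q) :=
  Measure.isProbabilityMeasure_map (Measurable.aemeasurable (by fun_prop))

/-- Convergence in distribution of a sequence of random vectors (or variables) on one probability
space to a probability distribution `ν`. -/
def ConvergesInLaw {Ω E : Type*} [MeasurableSpace Ω] (P : Measure Ω) [IsProbabilityMeasure P]
    [TopologicalSpace E] [MeasurableSpace E] [OpensMeasurableSpace E]
    (X : ℕ → Ω → E) (ν : Measure E) [IsProbabilityMeasure ν] : Prop :=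
  TendstoInDistribution X atTop (fun x : E => x) (fun _ => P) ν

end

end ExtremumTest

open ExtremumTest

open Asymptotics

namespace ExtremumTest

noncomputable section

/-! The argument is pathwise. On almost every path, with `z n` the score at `β₀` and `C = G A⁻¹`,
all ingredients are linear in `z n` up to `o(‖z n‖)`: `g(bhat)` and `G (bhat - btil)` are both `-C
z`, the multiplier is `-S⁻¹ C z`, and the score at `btil` is `Gᵀ` times the multiplier
(`pathwise_expansions`). No rate of convergence is needed beforehand: remainders are first measured
against the estimation errors themselves and then absorbed.

Substituting, each statistic equals the Wald form `f(Z) = Zᵀ Cᵀ Ω⁻¹ C Z` at `Z = √n z`, up to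
`o(‖Z‖²)` (`isLittleO_statistics`). A Slutsky argument discards the error
(`convergesInLaw_of_isLittleO`). Since `Ω = C B Cᵀ`, the form `f` of an `N(0, B)` vector is the
squared norm of a standard Gaussian vector in dimension `q` (`map_wald_multivariateGaussian`).

Invertibility of `S` is not assumed. It holds because `A` is a limit of Hessians at interior maxima,
so that the nonsingular `-A` is positive definite. -/

/-- A matrix as a continuous linear map between Euclidean spaces. -/
def mv {m n : ℕ} (M : Matrix (Fin m) (Fin n) ℝ) : Vec n →L[ℝ] Vec m :=
  LinearMap.toContinuousLinearMap (Matrix.toLpLin 2 2 M)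

section mv

variable {l m n : ℕ}

lemma mv_apply (M : Matrix (Fin m) (Fin n) ℝ) (x : Vec n) :
    mv M x = WithLp.toLp 2 (M *ᵥ x.ofLp) := rfl

@[simp]
lemma ofLp_mv (M : Matrix (Fin m) (Fin n) ℝ) (x : Vec n) : (mv M x).ofLp = M *ᵥ x.ofLp := rfl

lemma mv_mul (M : Matrix (Fin l) (Fin m) ℝ) (N : Matrix (Fin m) (Fin n) ℝ) (x : Vec n) :
    mv (M * N) x = mv M (mv N x) := by
  simp [mv_apply]

@[simp]
lemma mv_one (x : Vec n) : mv (1 : Matrix (Fin n) (Fin n) ℝ) x = x := by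
  simp [mv_apply]

lemma mv_neg (M : Matrix (Fin m) (Fin n) ℝ) (x : Vec n) : mv (-M) x = -mv M x := by
  simp [mv_apply, Matrix.neg_mulVec]

lemma mv_sub (M N : Matrix (Fin m) (Fin n) ℝ) : mv (M - N) = mv M - mv N := by
  ext x
  simp [Matrix.sub_mulVec]

lemma inner_eq_dotProduct (x y : Vec n) : inner ℝ x y = x.ofLp ⬝ᵥ y.ofLp := by
  simp [EuclideanSpace.inner_eq_star_dotProduct, dotProduct_comm]

lemma inner_mv_left (M : Matrix (Fin m) (Fin n) ℝ) (x : Vec n) (y : Vec m) :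
    inner ℝ (mv M x) y = inner ℝ x (mv Mᵀ y) := by
  simp only [inner_eq_dotProduct, ofLp_mv, Matrix.dotProduct_mulVec, Matrix.vecMul_transpose]

lemma continuous_mv : Continuous (mv : Matrix (Fin m) (Fin n) ℝ → Vec n →L[ℝ] Vec m) := by
  let f : Matrix (Fin m) (Fin n) ℝ →ₗ[ℝ] (Vec n →L[ℝ] Vec m) :=
    (LinearMap.toContinuousLinearMap (𝕜 := ℝ) (E := Vec n) (F' := Vec m)).toLinearMap ∘ₗ
      (Matrix.toLpLin 2 2).toLinearMap
  exact f.continuous_of_finiteDimensional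

lemma mv_jacobian {p q : ℕ} (g : Vec p → Vec q) (β : Vec p) : mv (jacobian g β) = fderiv ℝ g β := by
  ext v i
  conv_rhs => rw [← (EuclideanSpace.basisFun (Fin p) ℝ).sum_repr v]
  simp [jacobian, Matrix.mulVec, dotProduct, mul_comm]

end mv

/-! ### Second derivatives and the second-order necessary condition -/

section Hessian

variable {p : ℕ} {Q : Vec p → ℝ} {β : Vec p}

lemma inner_score (Q : Vec p → ℝ) (β v : Vec p) : inner ℝ (score Q β) v = fderiv ℝ Q β v := by
  simp [score, gradient]

lemma fderiv_fderiv_apply (Q : Vec p → ℝ) (β v w : Vec p) :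
    fderiv ℝ (fderiv ℝ Q) β v w = inner ℝ (mv (hessian Q β)ᵀ v) w := by
  conv_lhs => rw [← (EuclideanSpace.basisFun (Fin p) ℝ).sum_repr v,
    ← (EuclideanSpace.basisFun (Fin p) ℝ).sum_repr w]
  simp [hessian, inner_eq_dotProduct, Matrix.mulVec, dotProduct, Finset.sum_mul, Finset.mul_sum]
  refine Finset.sum_congr rfl fun i _ => Finset.sum_congr rfl fun j _ => by ring

lemma differentiableAt_fderiv (h : ContDiffAt ℝ 2 Q β) : DifferentiableAt ℝ (fderiv ℝ Q) β :=
  (h.fderiv_right (m := 1) (by norm_num)).differentiableAt (by norm_num)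

lemma hasFDerivAt_score (h : ContDiffAt ℝ 2 Q β) :
    HasFDerivAt (score Q) (mv (hessian Q β)ᵀ) β := by
  have h1 := (InnerProductSpace.toDual ℝ (Vec p)).symm.toContinuousLinearEquiv.hasFDerivAt.comp β
    (differentiableAt_fderiv h).hasFDerivAt
  refine HasFDerivAt.congr_fderiv (f := score Q) h1 ?_
  ext1 v
  refine ext_inner_right ℝ fun w => ?_
  rw [← fderiv_fderiv_apply]
  simp

lemma hessian_transpose (h : ContDiffAt ℝ 2 Q β) : (hessian Q β)ᵀ = hessian Q β := by
  have := h.isSymmSndFDerivAt (by simp)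
  ext i j
  exact this _ _

lemma continuousOn_hessian {V : Set (Vec p)} (hV : IsOpen V) (h : ContDiffOn ℝ 2 Q V) (i j : Fin p) :
    ContinuousOn (fun β => hessian Q β i j) V := by
  have h1 : ContDiffOn ℝ 1 (fderiv ℝ Q) V := h.fderiv_of_isOpen hV (by norm_num)
  have h0 : ContinuousOn (fderiv ℝ (fderiv ℝ Q)) V := h1.continuousOn_fderiv_of_isOpen hV le_rfl
  exact (h0.clm_apply continuousOn_const).clm_apply continuousOn_const

/-- At an interior maximum the Hessian is negative semidefinite. -/
lemma inner_hessian_nonpos (h : ContDiffAt ℝ 2 Q β) (hmax : IsLocalMax Q β) (v : Vec p) :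
    inner ℝ (mv (hessian Q β)ᵀ v) v ≤ 0 := by
  by_contra! hpos
  rw [← fderiv_fderiv_apply] at hpos
  set f : ℝ → ℝ := fun t => Q (β + t • v) with hf
  have hline : Continuous fun t : ℝ => β + t • v := by fun_prop
  have hlt : Tendsto (fun t : ℝ => β + t • v) (𝓝 0) (𝓝 β) := by
    simpa using hline.tendsto 0
  have hld (t : ℝ) : HasDerivAt (fun t : ℝ => β + t • v) v t := by
    simpa using ((hasDerivAt_id t).smul_const v).const_add β
  have hev : ∀ᶠ x in 𝓝 β, DifferentiableAt ℝ Q x := by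
    filter_upwards [h.eventually (by simp)] with x hx
    exact hx.differentiableAt (by norm_num)
  have hd1 : deriv f =ᶠ[𝓝 0] fun t => fderiv ℝ Q (β + t • v) v := by
    filter_upwards [hlt.eventually hev] with t ht
    exact (ht.hasFDerivAt.comp_hasDerivAt t (hld t)).deriv
  have hd2 : deriv (deriv f) 0 = fderiv ℝ (fderiv ℝ Q) β v v := by
    rw [hd1.deriv_eq]
    have hD : HasFDerivAt (fderiv ℝ Q) (fderiv ℝ (fderiv ℝ Q) β) (β + (0 : ℝ) • v) := by
      simpa using (differentiableAt_fderiv h).hasFDerivAt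
    have h1 : HasDerivAt (fun t : ℝ => fderiv ℝ Q (β + t • v)) (fderiv ℝ (fderiv ℝ Q) β v) 0 :=
      HasFDerivAt.comp_hasDerivAt (l := fderiv ℝ Q) (0 : ℝ) hD (hld 0)
    have h2 := h1.clm_apply (hasDerivAt_const (0 : ℝ) v)
    rw [h2.deriv]
    simp only [map_zero, add_zero]
  have hfmax : IsLocalMax f 0 := by
    have : ∀ᶠ t in 𝓝 (0 : ℝ), Q (β + t • v) ≤ Q β := hlt.eventually hmax
    filter_upwards [this] with t ht
    simpa [hf] using ht
  have hfc : ContinuousAt f 0 := by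
    have : ContinuousAt Q (β + (0 : ℝ) • v) := by simpa using h.continuousAt
    exact ContinuousAt.comp (f := fun t : ℝ => β + t • v) this hline.continuousAt
  -- A positive second derivative at a critical point makes `0` a local minimum as well, so `f` is
  -- locally constant and its second derivative vanishes.
  have hfmin : IsLocalMin f 0 :=
    isLocalMin_of_deriv_deriv_pos (by rw [hd2]; exact hpos) hfmax.deriv_eq_zero hfc
  have hconst : f =ᶠ[𝓝 0] fun _ => f 0 := by
    filter_upwards [hfmax, hfmin] with t h1 h2 using le_antisymm h1 h2
  have : deriv (deriv f) 0 = 0 := by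
    rw [hconst.deriv.deriv_eq]
    simp
  rw [hd2] at this
  exact hpos.ne' this

end Hessian

/-! ### Hessian limits and linearization of the score -/

section ScoreExpansion

variable {p : ℕ} {Q : ℕ → Vec p → ℝ} {V : Set (Vec p)} {β₀ : Vec p}
  {Alim : Vec p → Matrix (Fin p) (Fin p) ℝ}

/-- Uniform convergence makes `Alim` continuous at `β₀`, which allows the index and the evaluation
point to move together; this is needed at random points. -/
lemma tendsto_hessian (hV : IsOpen V) (hβ₀ : β₀ ∈ V) (hQ : ∀ n, ContDiffOn ℝ 2 (Q n) V)
    (hA : ∀ i j, TendstoUniformlyOn (fun n β => hessian (Q n) β i j) (fun β => Alim β i j) atTop V) :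
    Tendsto (fun x : ℕ × Vec p => hessian (Q x.1) x.2) (atTop ×ˢ 𝓝 β₀) (𝓝 (Alim β₀)) := by
  refine tendsto_pi_nhds.2 fun i => tendsto_pi_nhds.2 fun j => ?_
  have hc : ContinuousAt (fun β => Alim β i j) β₀ :=
    ((hA i j).continuousOn (Frequently.of_forall fun n =>
      continuousOn_hessian hV (hQ n) i j)).continuousAt (hV.mem_nhds hβ₀)
  have hf : TendstoUniformlyOnFilter (fun n β => hessian (Q n) β i j) (fun β => Alim β i j) atTop
      (𝓝 β₀) :=
    (hA i j).tendstoUniformlyOnFilter.mono_right (le_principal_iff.2 (hV.mem_nhds hβ₀))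
  rw [Metric.tendsto_nhds]
  intro ε hε
  rw [Metric.tendstoUniformlyOnFilter_iff] at hf
  have h1 := hf (ε / 2) (half_pos hε)
  have h2 : ∀ᶠ x : ℕ × Vec p in atTop ×ˢ 𝓝 β₀, dist (Alim x.2 i j) (Alim β₀ i j) < ε / 2 :=
    tendsto_snd.eventually (Metric.tendsto_nhds.1 hc (ε / 2) (half_pos hε))
  filter_upwards [h1, h2] with x hx1 hx2
  rw [dist_comm] at hx1
  linarith [dist_triangle (hessian (Q x.1) x.2 i j) (Alim x.2 i j) (Alim β₀ i j)]

lemma tendsto_hessian_seq (hV : IsOpen V) (hβ₀ : β₀ ∈ V) (hQ : ∀ n, ContDiffOn ℝ 2 (Q n) V)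
    (hA : ∀ i j, TendstoUniformlyOn (fun n β => hessian (Q n) β i j) (fun β => Alim β i j) atTop V)
    {x : ℕ → Vec p} (hx : Tendsto x atTop (𝓝 β₀)) :
    Tendsto (fun n => hessian (Q n) (x n)) atTop (𝓝 (Alim β₀)) := by
  have h : Tendsto (fun n => (n, x n)) atTop (atTop ×ˢ 𝓝 β₀) := tendsto_id.prodMk hx
  have h1 := tendsto_hessian hV hβ₀ hQ hA
  have h2 := h1.comp h
  simpa only [Function.comp_def] using h2

lemma transpose_eq_of_tendsto_hessian (hV : IsOpen V) (hβ₀ : β₀ ∈ V)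
    (hQ : ∀ n, ContDiffOn ℝ 2 (Q n) V)
    (hA : ∀ i j, TendstoUniformlyOn (fun n β => hessian (Q n) β i j) (fun β => Alim β i j) atTop V) :
    (Alim β₀)ᵀ = Alim β₀ := by
  have h : Tendsto (fun n => hessian (Q n) β₀) atTop (𝓝 (Alim β₀)) :=
    tendsto_hessian_seq hV hβ₀ hQ hA tendsto_const_nhds
  have h' : Tendsto (fun n => (hessian (Q n) β₀)ᵀ) atTop (𝓝 (Alim β₀)ᵀ) :=
    (continuous_id.matrix_transpose.tendsto _).comp h
  simp only [hessian_transpose ((hQ _).contDiffAt (hV.mem_nhds hβ₀))] at h'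
  exact tendsto_nhds_unique h' h

/-- Linearization of the score at the true parameter. -/
lemma score_expansion (hV : IsOpen V) (hβ₀ : β₀ ∈ V) (hQ : ∀ n, ContDiffOn ℝ 2 (Q n) V)
    (hA : ∀ i j, TendstoUniformlyOn (fun n β => hessian (Q n) β i j) (fun β => Alim β i j) atTop V)
    {x : ℕ → Vec p} (hx : Tendsto x atTop (𝓝 β₀)) :
    (fun n => score (Q n) (x n) - score (Q n) β₀ - mv (Alim β₀) (x n - β₀)) =o[atTop]
      fun n => x n - β₀ := by
  have hH : Tendsto (fun x : ℕ × Vec p => mv (hessian (Q x.1) x.2)) (atTop ×ˢ 𝓝 β₀)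
      (𝓝 (mv (Alim β₀))) := (continuous_mv.tendsto _).comp (tendsto_hessian hV hβ₀ hQ hA)
  refine isLittleO_iff.2 fun ε hε => ?_
  have h1 := Metric.tendsto_nhds.1 hH ε hε
  obtain ⟨pa, hpa, pb, hpb, hab⟩ := eventually_prod_iff.1 h1
  obtain ⟨δ, hδ, hball⟩ := Metric.eventually_nhds_iff_ball.1 (hpb.and (hV.mem_nhds hβ₀))
  filter_upwards [hpa, hx.eventually (Metric.ball_mem_nhds β₀ hδ)] with n hn hxn
  -- Mean value inequality on a ball where, for all large `n`, the derivative of the score is within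
  -- `ε` of `mv (Alim β₀)`.
  refine (convex_ball β₀ δ).norm_image_sub_le_of_norm_hasFDerivWithin_le'
    (f' := fun y => mv (hessian (Q n) y)) (fun y hy => ?_) (fun y hy => ?_)
    (Metric.mem_ball_self hδ) hxn
  · have hc := (hQ n).contDiffAt (hV.mem_nhds (hball y hy).2)
    have := hasFDerivAt_score hc
    rw [hessian_transpose hc] at this
    exact this.hasFDerivWithinAt
  · rw [← dist_eq_norm]
    exact (hab hn (hball y hy).1).le

/-- If the `Q n` have local maxima converging to `β₀`, then the limit of the Hessians at `β₀` is
negative semidefinite. -/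
lemma inner_limit_hessian_nonpos (hV : IsOpen V) (hβ₀ : β₀ ∈ V) (hQ : ∀ n, ContDiffOn ℝ 2 (Q n) V)
    (hA : ∀ i j, TendstoUniformlyOn (fun n β => hessian (Q n) β i j) (fun β => Alim β i j) atTop V)
    {x : ℕ → Vec p} (hx : Tendsto x atTop (𝓝 β₀)) (hmax : ∀ᶠ n in atTop, IsLocalMax (Q n) (x n))
    (v : Vec p) : inner ℝ (mv (Alim β₀) v) v ≤ 0 := by
  have hH : Tendsto (fun n => mv (hessian (Q n) (x n))) atTop (𝓝 (mv (Alim β₀))) :=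
    (continuous_mv.tendsto _).comp (tendsto_hessian_seq hV hβ₀ hQ hA hx)
  have h1 : Tendsto (fun n => inner ℝ (mv (hessian (Q n) (x n)) v) v) atTop
      (𝓝 (inner ℝ (mv (Alim β₀) v) v)) :=
    (((ContinuousLinearMap.apply ℝ (Vec p) v).continuous.tendsto _).comp hH).inner
      tendsto_const_nhds
  refine le_of_tendsto h1 ?_
  filter_upwards [hmax, hx.eventually (hV.mem_nhds hβ₀)] with n hn hxn
  have hc := (hQ n).contDiffAt (hV.mem_nhds hxn)
  simpa [hessian_transpose hc] using inner_hessian_nonpos hc hn v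

end ScoreExpansion

/-- Consistency of approximate maximizers of uniformly convergent functions on a compact set. -/
lemma tendsto_of_uniform_limit_of_unique_max {E : Type*} [TopologicalSpace E] {K : Set E}
    (hK : IsCompact K) {β₀ : E}
    (hβ₀ : β₀ ∈ K) {Q : ℕ → E → ℝ} (hcont : ∀ n, ContinuousOn (Q n) K) {Qlim : E → ℝ}
    (hlim : TendstoUniformlyOn Q Qlim atTop K) (hident : ∀ β ∈ K, β ≠ β₀ → Qlim β < Qlim β₀)
    {x : ℕ → E} (hx : ∀ n, x n ∈ K) (hge : ∀ n, Q n β₀ ≤ Q n (x n)) :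
    Tendsto x atTop (𝓝 β₀) := by
  have hlc : ContinuousOn Qlim K := hlim.continuousOn (Frequently.of_forall hcont)
  refine tendsto_nhds.2 fun U hU hβU => ?_
  change ∀ᶠ n in atTop, x n ∈ U
  rcases (K \ U).eq_empty_or_nonempty with he | hne
  · refine Eventually.of_forall fun n => ?_
    by_contra h
    exact Set.eq_empty_iff_forall_notMem.1 he (x n) ⟨hx n, h⟩
  -- The best value of `Qlim` outside `U` falls short of `Qlim β₀` by a positive gap; once the
  -- uniform error is below half of it, a point outside `U` cannot beat `β₀`.
  obtain ⟨m, hm, hmax⟩ := (hK.diff hU).exists_isMaxOn hne (hlc.mono Set.sdiff_subset)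
  have hlt : Qlim m < Qlim β₀ := hident m hm.1 fun h => hm.2 (h ▸ hβU)
  filter_upwards [Metric.tendstoUniformlyOn_iff.1 hlim ((Qlim β₀ - Qlim m) / 2) (by linarith)]
    with n hn
  by_contra h
  have h1 := hn (x n) (hx n)
  have h2 := hn β₀ hβ₀
  have h3 : Qlim (x n) ≤ Qlim m := hmax ⟨hx n, h⟩
  rw [Real.dist_eq, abs_lt] at h1 h2
  linarith [hge n]

/-! ### Lagrange multipliers -/

section Multiplier

variable {p q : ℕ} {Q : Vec p → ℝ} {g : Vec p → Vec q} {b : Vec p}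

lemma solvesFirstOrderCondition_iff (hQ : DifferentiableAt ℝ Q b) (hg : DifferentiableAt ℝ g b)
    (l : Vec q) : SolvesFirstOrderCondition Q g b l ↔ score Q b = mv (jacobian g b)ᵀ l := by
  have h : HasFDerivAt (fun β => lagrangian Q g β l)
      (fderiv ℝ Q b - (innerSL ℝ l).comp (fderiv ℝ g b)) b := by
    have h1 := hQ.hasFDerivAt.sub ((innerSL ℝ l).hasFDerivAt.comp b hg.hasFDerivAt)
    refine h1.congr_of_eventuallyEq (Eventually.of_forall fun β => ?_)
    simp [lagrangian, inner_eq_dotProduct, dotProduct_comm]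
  have h' : fderiv ℝ Q b - (innerSL ℝ l).comp (fderiv ℝ g b) = 0 ↔
      score Q b = mv (jacobian g b)ᵀ l := by
    rw [sub_eq_zero]
    constructor
    · intro heq
      refine ext_inner_right ℝ fun v => ?_
      rw [inner_score, heq, inner_mv_left, Matrix.transpose_transpose, mv_jacobian]
      simp
    · intro heq
      ext v
      rw [← inner_score, heq, inner_mv_left, Matrix.transpose_transpose, mv_jacobian]
      simp
  rw [← h']
  exact ⟨fun hs => h.unique hs, fun h0 => by rwa [h0] at h⟩

lemma exists_solvesFirstOrderCondition (hQ : ContDiffAt ℝ 1 Q b) (hg : ContDiffAt ℝ 1 g b)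
    (hsurj : Function.Surjective (fderiv ℝ g b)) (hmax : IsLocalMaxOn Q {x | g x = g b} b) :
    ∃ l, SolvesFirstOrderCondition Q g b l := by
  obtain ⟨Λ, Λ₀, hne, hΛ⟩ := IsLocalExtrOn.exists_linear_map_of_hasStrictFDerivAt (Or.inr hmax)
    (hg.hasStrictFDerivAt (by norm_num)) (hQ.hasStrictFDerivAt (by norm_num))
  -- The multiplier rule gives a nontrivial pair with `Λ ∘ g' + Λ₀ Q' = 0`. Surjectivity of `g'`
  -- excludes the abnormal case, and dividing by `-Λ₀` gives the multiplier.
  have hΛ₀ : Λ₀ ≠ 0 := by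
    rintro rfl
    refine hne (Prod.ext (LinearMap.ext fun y => ?_) rfl)
    obtain ⟨x, rfl⟩ := hsurj y
    simpa using hΛ x
  refine ⟨-Λ₀⁻¹ • (InnerProductSpace.toDual ℝ (Vec q)).symm (LinearMap.toContinuousLinearMap Λ),
    (solvesFirstOrderCondition_iff (hQ.differentiableAt (by norm_num))
      (hg.differentiableAt (by norm_num)) _).2 ?_⟩
  refine ext_inner_right ℝ fun v => ?_
  rw [inner_score, inner_mv_left, Matrix.transpose_transpose, mv_jacobian, real_inner_smul_left,
    InnerProductSpace.toDual_symm_apply]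
  have := hΛ v
  simp only [smul_eq_mul] at this
  rw [LinearMap.coe_toContinuousLinearMap']
  field_simp
  linarith

lemma score_eq_of_isLagrangeMultiplier (hQ : ContDiffAt ℝ 1 Q b) (hg : ContDiffAt ℝ 1 g b)
    (hsurj : Function.Surjective (fderiv ℝ g b)) {Bset : Set (Vec p)} (hB : Bset ∈ 𝓝 b)
    {lam : Vec q} (hb : IsConstrainedEstimator Q g Bset lam b)
    (hlam : IsLagrangeMultiplier Q g b lam) : score Q b = mv (jacobian g b)ᵀ lam := by
  have hmax : IsLocalMaxOn Q {x | g x = g b} b := by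
    filter_upwards [mem_nhdsWithin_of_mem_nhds hB, self_mem_nhdsWithin] with x hxB hxg
    have hxg : g x = g b := hxg
    have := hb.2 (show x ∈ {β ∈ Bset | g β = 0} from ⟨hxB, hxg.trans hb.1.2⟩)
    simpa [lagrangian, hxg] using this
  exact (solvesFirstOrderCondition_iff (hQ.differentiableAt (by norm_num))
    (hg.differentiableAt (by norm_num)) _).1
    (hlam (exists_solvesFirstOrderCondition hQ hg hsurj hmax))

lemma IsConstrainedEstimator.le {Bset : Set (Vec p)} {lam : Vec q} {β₀ : Vec p}
    (hb : IsConstrainedEstimator Q g Bset lam b) (hβ₀ : β₀ ∈ Bset) (hg : g β₀ = 0) :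
    Q β₀ ≤ Q b := by
  have := hb.2 (show β₀ ∈ {β ∈ Bset | g β = 0} from ⟨hβ₀, hg⟩)
  simpa [lagrangian, hg, hb.1.2] using this

lemma score_eq_zero_of_isLocalMax (h : IsLocalMax Q b) : score Q b = 0 := by
  simp [score, gradient, h.fderiv_eq_zero]

end Multiplier

section FullRank

variable {p q : ℕ} {G : Matrix (Fin q) (Fin p) ℝ}

lemma isUnit_det_mul_transpose (hG : G.rank = q) : IsUnit (G * Gᵀ).det := by
  have h : (G * Gᵀ).rank = q := by rw [Matrix.rank_self_mul_transpose, hG]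
  rw [← Matrix.isUnit_iff_isUnit_det, ← Matrix.linearIndependent_rows_iff_isUnit,
    linearIndependent_iff_card_eq_finrank_span]
  rw [Matrix.rank_eq_finrank_span_row] at h
  simpa [Set.finrank] using h.symm

lemma continuous_jacobian {g : Vec p → Vec q} (hg : ContDiff ℝ 1 g) : Continuous (jacobian g) := by
  have := hg.continuous_fderiv (by norm_num)
  refine continuous_matrix fun i j => ?_
  have h1 : Continuous fun β => fderiv ℝ g β (EuclideanSpace.single j 1) := by fun_prop
  exact (EuclideanSpace.proj (𝕜 := ℝ) i).continuous.comp h1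

/-- Full rank is an open condition: pairing the moving Jacobian with the fixed `Jᵀ` gives a
determinant that is nonzero at `β₀`, and an explicit right inverse wherever it stays nonzero. -/
lemma eventually_surjective_fderiv {g : Vec p → Vec q} (hg : ContDiff ℝ 1 g) {β₀ : Vec p}
    (hG : (jacobian g β₀).rank = q) :
    ∀ᶠ β in 𝓝 β₀, Function.Surjective (fderiv ℝ g β) := by
  set J := jacobian g β₀
  have hc : Continuous fun β => (jacobian g β * Jᵀ).det :=
    ((continuous_jacobian hg).matrix_mul continuous_const).matrix_det
  filter_upwards [hc.continuousAt.eventually_ne (isUnit_det_mul_transpose hG).ne_zero] with β hβ y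
  refine ⟨mv Jᵀ (mv (jacobian g β * Jᵀ)⁻¹ y), ?_⟩
  rw [← mv_jacobian, ← mv_mul, ← mv_mul, Matrix.mul_nonsing_inv _ (isUnit_iff_ne_zero.2 hβ), mv_one]

end FullRank

/-! ### From linear expansions to quadratic forms -/

section Quadratic

variable {p m : ℕ} {z : ℕ → Vec p}

lemma isLittleO_inner_sub_inner {x y : ℕ → Vec m} {X Y : Matrix (Fin m) (Fin p) ℝ}
    (hx : (fun n => x n - mv X (z n)) =o[atTop] z) (hy : (fun n => y n - mv Y (z n)) =o[atTop] z) :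
    (fun n => inner ℝ (x n) (y n) - inner ℝ (z n) (mv (Xᵀ * Y) (z n))) =o[atTop]
      fun n => ‖z n‖ ^ 2 := by
  have hX : (fun n => mv X (z n)) =O[atTop] z := (mv X).isBigO_comp _ _
  have hY : (fun n => mv Y (z n)) =O[atTop] z := (mv Y).isBigO_comp _ _
  have hyO : y =O[atTop] z := by
    have := hy.isBigO.add hY
    simpa using this
  have key {E : Type} [NormedAddCommGroup E] [InnerProductSpace ℝ E] (u v : ℕ → E) :
      (fun n => inner ℝ (u n) (v n)) =O[atTop] fun n => ‖u n‖ * ‖v n‖ :=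
    isBigO_of_le _ fun n => by simpa using norm_inner_le_norm (𝕜 := ℝ) (u n) (v n)
  have h1 : (fun n => inner ℝ (x n - mv X (z n)) (y n)) =o[atTop] fun n => ‖z n‖ ^ 2 := by
    simp only [pow_two]
    exact (key _ _).trans_isLittleO (hx.norm_norm.mul_isBigO hyO.norm_norm)
  have h2 : (fun n => inner ℝ (mv X (z n)) (y n - mv Y (z n))) =o[atTop] fun n => ‖z n‖ ^ 2 := by
    simp only [pow_two]
    exact (key _ _).trans_isLittleO (hX.norm_norm.mul_isLittleO hy.norm_norm)
  refine (h1.add h2).congr_left fun n => ?_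
  rw [mv_mul, ← inner_mv_left, inner_sub_left, inner_sub_right]
  ring

/-- The factor `n` in the statistics is exactly what turns `‖z‖²` into `‖√n z‖²`, the scale on which
the score converges in law. -/
lemma isLittleO_scale {f : ℕ → ℝ} (hf : f =o[atTop] fun n => ‖z n‖ ^ 2) :
    (fun n : ℕ => n * f n) =o[atTop] fun n => ‖√(n : ℝ) • z n‖ ^ 2 := by
  refine ((isBigO_refl (fun n : ℕ => (n : ℝ)) atTop).mul_isLittleO hf).congr_right fun n => ?_
  rw [norm_smul, mul_pow, Real.norm_eq_abs, sq_abs, Real.sq_sqrt (Nat.cast_nonneg n)]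

lemma inner_sqrt_smul (n : ℕ) (v : Vec p) (K : Matrix (Fin p) (Fin p) ℝ) :
    inner ℝ (√(n : ℝ) • v) (mv K (√(n : ℝ) • v)) = n * inner ℝ v (mv K v) := by
  rw [map_smul, real_inner_smul_left, real_inner_smul_right, ← mul_assoc,
    Real.mul_self_sqrt (Nat.cast_nonneg n)]

lemma isLittleO_bilinear_statistic {x y : ℕ → Vec m} {X Y : Matrix (Fin m) (Fin p) ℝ}
    {K : Matrix (Fin p) (Fin p) ℝ}
    (hx : (fun n => x n - mv X (z n)) =o[atTop] z) (hy : (fun n => y n - mv Y (z n)) =o[atTop] z)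
    (hK : Xᵀ * Y = K) :
    (fun n : ℕ => n * inner ℝ (x n) (y n) -
      inner ℝ (√(n : ℝ) • z n) (mv K (√(n : ℝ) • z n))) =o[atTop]
      fun n => ‖√(n : ℝ) • z n‖ ^ 2 := by
  subst hK
  refine (isLittleO_scale (isLittleO_inner_sub_inner hx hy)).congr_left fun n => ?_
  rw [inner_sqrt_smul]
  ring

lemma isLittleO_mv_comp {k : ℕ} {x : ℕ → Vec m} {X : Matrix (Fin m) (Fin p) ℝ}
    (hx : (fun n => x n - mv X (z n)) =o[atTop] z) (N : Matrix (Fin k) (Fin m) ℝ) :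
    (fun n => mv N (x n) - mv (N * X) (z n)) =o[atTop] z := by
  refine (((mv N).isBigO_comp _ _).trans_isLittleO hx).congr_left fun n => ?_
  rw [mv_mul, map_sub]

end Quadratic

lemma matS_eq {p q : ℕ} {A : Matrix (Fin p) (Fin p) ℝ} {G : Matrix (Fin q) (Fin p) ℝ}
    (hA : IsUnit A.det) : matS G A = -(G * A⁻¹ * Gᵀ) := by
  have : (-A)⁻¹ = -A⁻¹ := by
    refine Matrix.inv_eq_left_inv ?_
    rw [neg_mul_neg, Matrix.nonsing_inv_mul _ hA]
  rw [matS, this, Matrix.mul_neg, Matrix.neg_mul]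

/-! ### Solving the perturbed first-order conditions -/

section LinearSystem

variable {p q : ℕ} {A : Matrix (Fin p) (Fin p) ℝ} {G : Matrix (Fin q) (Fin p) ℝ}
  {z a d s : ℕ → Vec p} {l γ : ℕ → Vec q}

/-- The term `-z n` is the score difference when the score at the maximizer vanishes. Applying `A⁻¹`
leaves an error `o(a)`, which is absorbed to give `a = O(z)`. -/
lemma unconstrained_expansion (hA : IsUnit A.det) (h : (fun n => -z n - mv A (a n)) =o[atTop] a) :
    (fun n => a n - mv (-A⁻¹) (z n)) =o[atTop] z ∧ a =O[atTop] z := by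
  have h1 : (fun n => a n - mv (-A⁻¹) (z n)) =o[atTop] a := by
    refine (((mv (-A⁻¹)).isBigO_comp _ _).trans_isLittleO h).congr_left fun n => ?_
    rw [map_sub, ← mv_mul, Matrix.neg_mul, Matrix.nonsing_inv_mul _ hA, mv_neg, mv_neg, mv_neg,
      map_neg, mv_one]
    abel
  have h2 : a =O[atTop] z :=
    h1.right_isBigO_sub.trans
      (((mv (-A⁻¹)).isBigO_comp z atTop).congr_left fun n => by simp)
  exact ⟨h1.trans_isBigO h2, h2⟩

lemma constrained_expansion (hA : IsUnit A.det) (hS : IsUnit (matS G A).det)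
    (h2 : (fun n => s n - z n - mv A (d n)) =o[atTop] d)
    (h3 : (fun n => mv G (d n)) =o[atTop] d)
    (h4 : (fun n => s n - mv Gᵀ (l n)) =o[atTop] l) :
    (fun n => l n - mv (-((matS G A)⁻¹ * (G * A⁻¹))) (z n)) =o[atTop] z ∧
      d =O[atTop] z ∧ l =O[atTop] z := by
  set S := matS G A
  have hSeq : S = -(G * A⁻¹ * Gᵀ) := matS_eq hA
  set r : ℕ → Vec p × Vec q := fun n => (d n, l n) with hr
  -- Neither unknown is bounded by `z` yet, so errors are measured against the pair `r = (d, l)`.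
  have hdr : d =O[atTop] r := isBigO_fst_prod
  have hlr : l =O[atTop] r := isBigO_snd_prod
  have e1 : (fun n => d n + mv A⁻¹ (z n) - mv (A⁻¹ * Gᵀ) (l n)) =o[atTop] r := by
    refine (((mv A⁻¹).isBigO_comp _ _).trans_isLittleO
      ((h4.trans_isBigO hlr).sub (h2.trans_isBigO hdr))).congr_left fun n => ?_
    have : s n - mv Gᵀ (l n) - (s n - z n - mv A (d n)) = z n + mv A (d n) - mv Gᵀ (l n) := by abel
    rw [this, map_sub, map_add, ← mv_mul, ← mv_mul, Matrix.nonsing_inv_mul _ hA, mv_one]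
    abel
  have e2 : (fun n => l n - mv (-(S⁻¹ * (G * A⁻¹))) (z n)) =o[atTop] r := by
    -- Applying `G` eliminates `d`, because `G d` is negligible, and leaves `S l + G A⁻¹ z = o(r)`.
    have e3 : (fun n => mv G (d n + mv A⁻¹ (z n) - mv (A⁻¹ * Gᵀ) (l n)) - mv G (d n)) =o[atTop] r :=
      (((mv G).isBigO_comp _ _).trans_isLittleO e1).sub (h3.trans_isBigO hdr)
    refine (((mv S⁻¹).isBigO_comp _ _).trans_isLittleO e3).congr_left fun n => ?_
    have : mv S (l n) = - mv G (mv (A⁻¹ * Gᵀ) (l n)) := by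
      rw [hSeq, mv_neg, ← mv_mul, Matrix.mul_assoc]
    have : mv G (d n + mv A⁻¹ (z n) - mv (A⁻¹ * Gᵀ) (l n)) - mv G (d n) =
        mv (G * A⁻¹) (z n) + mv S (l n) := by
      rw [this, map_sub, map_add, mv_mul G A⁻¹]
      abel
    rw [this, map_add, ← mv_mul, ← mv_mul, Matrix.nonsing_inv_mul _ hS, mv_one, mv_neg]
    abel
  set X := -(S⁻¹ * (G * A⁻¹)) with hX
  have e4 : (fun n => d n - mv (A⁻¹ * Gᵀ * X - A⁻¹) (z n)) =o[atTop] r := by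
    refine (e1.add (((mv (A⁻¹ * Gᵀ)).isBigO_comp _ _).trans_isLittleO e2)).congr_left fun n => ?_
    rw [map_sub, ← mv_mul, mv_sub, _root_.sub_apply]
    abel
  -- Both components of `r` are linear in `z` up to `o(r)`; absorbing the error gives `r = O(z)`.
  have hrz : r =O[atTop] z := by
    refine ((e4.prod_left e2).right_isBigO_sub).trans ?_
    have hd := (mv (A⁻¹ * Gᵀ * X - A⁻¹)).isBigO_comp z atTop
    have hl := (mv X).isBigO_comp z atTop
    exact (hd.prod_left hl).congr_left fun n => by simp [hr]
  exact ⟨e2.trans_isBigO hrz, hdr.trans hrz, hlr.trans hrz⟩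

end LinearSystem

section MatrixIdentities

variable {p q : ℕ} {A B : Matrix (Fin p) (Fin p) ℝ} {G : Matrix (Fin q) (Fin p) ℝ}

lemma matS_transpose (hA : IsUnit A.det) (hAs : Aᵀ = A) : (matS G A)ᵀ = matS G A := by
  rw [matS_eq hA]
  simp [Matrix.transpose_mul, Matrix.transpose_nonsing_inv, hAs, Matrix.mul_assoc]

lemma matOmega_neg (hA : IsUnit A.det) : matOmega G A (-A) = matS G A := by
  rw [matS_eq hA, matOmega]
  simp only [Matrix.mul_neg, Matrix.neg_mul]
  rw [Matrix.mul_assoc (G * A⁻¹) A, Matrix.mul_nonsing_inv _ hA, Matrix.mul_one]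

lemma mul_pinv (hG : G.rank = q) : G * pinv G = 1 := by
  rw [pinv, ← Matrix.mul_assoc, Matrix.mul_nonsing_inv _ (isUnit_det_mul_transpose hG)]

/-- `S` is nonsingular when `A` is nonsingular, symmetric and negative semidefinite. -/
lemma isUnit_det_matS (hA : IsUnit A.det) (hAs : Aᵀ = A) (hneg : ∀ v, inner ℝ (mv A v) v ≤ 0)
    (hG : G.rank = q) : IsUnit (matS G A).det := by
  have hpsd : (-A).PosSemidef := by
    refine Matrix.PosSemidef.of_dotProduct_mulVec_nonneg ?_ fun x => ?_
    · rw [Matrix.IsHermitian, Matrix.conjTranspose_eq_transpose_of_trivial, Matrix.transpose_neg,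
        hAs]
    · have := hneg (WithLp.toLp 2 x)
      rw [real_inner_comm, inner_eq_dotProduct, ofLp_mv] at this
      simpa [Matrix.neg_mulVec] using this
  -- Semidefinite and invertible means definite; the inverse stays definite, and so does its
  -- congruence by `G`, whose row action is injective.
  have hpd : (-A).PosDef := hpsd.posDef_iff_isUnit.2
    ((Matrix.isUnit_iff_isUnit_det _).2 (by simpa [Matrix.det_neg] using hA))
  have hinj : Function.Injective G.vecMul := by
    refine Function.LeftInverse.injective (g := (pinv G).vecMul) fun x => ?_
    simp only [Matrix.vecMul_vecMul, mul_pinv hG, Matrix.vecMul_one]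
  have := hpd.inv.mul_mul_conjTranspose_same hinj
  rw [Matrix.conjTranspose_eq_transpose_of_trivial] at this
  exact (Matrix.isUnit_iff_isUnit_det _).1 this.isUnit

end MatrixIdentities

/-! ### Quadratic forms of possibly degenerate Gaussian vectors -/

section Gaussian

open scoped MatrixOrder

variable {p q : ℕ}

/-- Compared through characteristic functions, so `B` may be singular. -/
lemma map_multivariateGaussian_eq_stdGaussian {B : Matrix (Fin p) (Fin p) ℝ} (hB : B.PosSemidef)
    {M : Matrix (Fin q) (Fin p) ℝ} (hM : M * B * Mᵀ = 1) :
    (multivariateGaussian 0 B).map (mv M) = stdGaussian (Vec q) := by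
  have : IsProbabilityMeasure ((multivariateGaussian 0 B).map (mv M)) :=
    Measure.isProbabilityMeasure_map (by fun_prop)
  refine Measure.ext_of_charFun ?_
  ext t
  have h : charFun ((multivariateGaussian 0 B).map (mv M)) t =
      charFun (multivariateGaussian 0 B) (mv Mᵀ t) := by
    rw [charFun_apply, charFun_apply, integral_map (by fun_prop) (by fun_prop)]
    simp_rw [inner_mv_left]
  rw [h, charFun_multivariateGaussian hB, charFun_stdGaussian]
  have h2 : (mv Mᵀ t).ofLp ⬝ᵥ B *ᵥ (mv Mᵀ t).ofLp = ‖t‖ ^ 2 := by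
    rw [← ofLp_mv B, ← inner_eq_dotProduct, inner_mv_left, Matrix.transpose_transpose, ← mv_mul,
      ← mv_mul, hM, mv_one, real_inner_self_eq_norm_sq]
  rw [h2]
  simp [neg_div]

lemma map_norm_sq_stdGaussian (q : ℕ) :
    (stdGaussian (Vec q)).map (fun x => ‖x‖ ^ 2) = chiSquare q := by
  rw [← map_pi_eq_stdGaussian, Measure.map_map (by fun_prop) (by fun_prop), chiSquare, stdNormals]
  congr 1
  ext x
  simp [EuclideanSpace.real_norm_sq_eq]

lemma map_quadraticForm_multivariateGaussian {B : Matrix (Fin p) (Fin p) ℝ} (hB : B.PosSemidef)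
    {M : Matrix (Fin q) (Fin p) ℝ} (hM : M * B * Mᵀ = 1) :
    (multivariateGaussian 0 B).map (fun z => inner ℝ z (mv (Mᵀ * M) z)) = chiSquare q := by
  rw [← map_norm_sq_stdGaussian, ← map_multivariateGaussian_eq_stdGaussian hB hM,
    Measure.map_map (by fun_prop) (by fun_prop)]
  congr 1
  ext z
  rw [Function.comp_apply, mv_mul, ← inner_mv_left, real_inner_self_eq_norm_sq]

/-- The quadratic form of a centred Gaussian vector that standardizes its image under `C`. -/
lemma map_wald_multivariateGaussian {B : Matrix (Fin p) (Fin p) ℝ} (hB : B.PosSemidef)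
    {C : Matrix (Fin q) (Fin p) ℝ} (hC : IsUnit (C * B * Cᵀ).det) :
    (multivariateGaussian 0 B).map (fun z => inner ℝ z (mv (Cᵀ * (C * B * Cᵀ)⁻¹ * C) z)) =
      chiSquare q := by
  set Ω := C * B * Cᵀ with hΩ
  have hΩp : Ω.PosSemidef := by
    simpa [Matrix.conjTranspose_eq_transpose_of_trivial] using hB.mul_mul_conjTranspose_same C
  -- With `R` the symmetric square root of `Ω`, the matrix `R⁻¹ C` standardizes the vector and
  -- factors the form.
  set R := CFC.sqrt Ω
  have hRR : R * R = Ω := CFC.sqrt_mul_sqrt_self _ hΩp.nonneg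
  have hRt : Rᵀ = R := by
    have := (CFC.sqrt_nonneg Ω).posSemidef.isHermitian
    rwa [Matrix.IsHermitian, Matrix.conjTranspose_eq_transpose_of_trivial] at this
  have hRdet : IsUnit R.det := by
    rw [← hRR, Matrix.det_mul] at hC
    exact isUnit_of_mul_isUnit_left hC
  have hM : R⁻¹ * C * B * (R⁻¹ * C)ᵀ = 1 := by
    rw [Matrix.transpose_mul, Matrix.transpose_nonsing_inv, hRt]
    calc R⁻¹ * C * B * (Cᵀ * R⁻¹) = R⁻¹ * Ω * R⁻¹ := by simp only [hΩ, Matrix.mul_assoc]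
      _ = 1 := by
        rw [← hRR, ← Matrix.mul_assoc, Matrix.nonsing_inv_mul _ hRdet, Matrix.one_mul,
          Matrix.mul_nonsing_inv _ hRdet]
  have hK : Cᵀ * Ω⁻¹ * C = (R⁻¹ * C)ᵀ * (R⁻¹ * C) := by
    rw [Matrix.transpose_mul, Matrix.transpose_nonsing_inv, hRt, ← hRR, Matrix.mul_inv_rev]
    simp only [Matrix.mul_assoc]
  rw [hK]
  exact map_quadraticForm_multivariateGaussian hB hM

end Gaussian

/-! ### Removal of the remainder -/

section Slutsky

/-- Slutsky's theorem in a pathwise form: an error of smaller order than `‖Z n‖ ^ 2` does not change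
the limit law of a continuous function of `Z n`. -/
lemma convergesInLaw_of_isLittleO {Ω : Type*} [MeasurableSpace Ω] {P : Measure Ω}
    [IsProbabilityMeasure P] {p : ℕ} {Z : ℕ → Ω → Vec p} {ν : Measure (Vec p)}
    [IsProbabilityMeasure ν] (hZ : ConvergesInLaw P Z ν) {Y : ℕ → Ω → ℝ}
    (hY : ∀ n, AEMeasurable (Y n) P) {f : Vec p → ℝ} (hf : Continuous f) {μ : Measure ℝ}
    [IsProbabilityMeasure μ] (hμ : ν.map f = μ)
    (h : ∀ᵐ ω ∂P, (fun n => Y n ω - f (Z n ω)) =o[atTop] fun n => ‖Z n ω‖ ^ 2) :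
    ConvergesInLaw P Y μ := by
  have hZm : ∀ n, AEMeasurable (Z n) P := hZ.forall_aemeasurable
  -- The normalized error tends to `0` almost surely, and `Y` is a continuous function of `(Z, X)`
  -- equal to `f` at `X = 0`. The added `1` avoids division by zero.
  set X : ℕ → Ω → ℝ := fun n ω => (Y n ω - f (Z n ω)) / (1 + ‖Z n ω‖ ^ 2) with hX
  have hpos (n : ℕ) (ω : Ω) : 0 < 1 + ‖Z n ω‖ ^ 2 := by positivity
  have hXm : ∀ n, AEMeasurable (X n) P := fun n =>
    ((hY n).sub (hf.measurable.comp_aemeasurable (hZm n))).div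
      (((hZm n).norm.pow_const 2).const_add 1)
  have hX0 : TendstoInMeasure P X atTop fun _ => (0 : ℝ) := by
    refine tendstoInMeasure_of_tendsto_ae (fun n => (hXm n).aestronglyMeasurable) ?_
    filter_upwards [h] with ω hω
    have : (fun n => Y n ω - f (Z n ω)) =o[atTop] fun n => 1 + ‖Z n ω‖ ^ 2 := by
      refine hω.trans_isBigO (isBigO_of_le _ fun n => ?_)
      rw [Real.norm_of_nonneg (by positivity), Real.norm_of_nonneg (hpos n ω).le]
      linarith
    exact this.tendsto_div_nhds_zero
  have hlim := hZ.continuous_comp_prodMk_of_tendstoInMeasure_const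
    (g := fun x : Vec p × ℝ => f x.1 + (1 + ‖x.1‖ ^ 2) * x.2) (by fun_prop) hX0 hXm
  have hfun (n : ℕ) : (fun ω => f (Z n ω) + (1 + ‖Z n ω‖ ^ 2) * X n ω) = Y n := by
    ext ω
    simp only [hX]
    rw [mul_div_cancel₀ _ (hpos n ω).ne']
    ring
  simp only [mul_zero, add_zero] at hlim
  refine ⟨hY, by fun_prop, ?_⟩
  have := hlim.tendsto
  simpa only [hμ, Measure.map_id', hfun] using this

end Slutsky

/-! ### Assembly of the expansions and the limit laws -/

/-- Pathwise expansions of the estimators and the multiplier in the score at the true parameter. -/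
lemma pathwise_expansions {p q : ℕ} {Q : ℕ → Vec p → ℝ} {Bset : Set (Vec p)}
    (hBset : IsCompact Bset) {β₀ : Vec p} (hβ₀ : β₀ ∈ interior Bset)
    (hQcont : ∀ n, ContinuousOn (Q n) Bset) {Qlim : Vec p → ℝ}
    (hQlim : TendstoUniformlyOn Q Qlim atTop Bset)
    (hident : ∀ β ∈ Bset, β ≠ β₀ → Qlim β < Qlim β₀)
    {V : Set (Vec p)} (hV : IsOpen V) (hβ₀V : β₀ ∈ V) (hQ : ∀ n, ContDiffOn ℝ 2 (Q n) V)
    {Alim : Vec p → Matrix (Fin p) (Fin p) ℝ}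
    (hAlim : ∀ i j,
      TendstoUniformlyOn (fun n β => hessian (Q n) β i j) (fun β => Alim β i j) atTop V)
    {A : Matrix (Fin p) (Fin p) ℝ} (hA : A = Alim β₀) (hAinv : IsUnit A.det)
    {g : Vec p → Vec q} (hg : ContDiff ℝ 1 g)
    {G : Matrix (Fin q) (Fin p) ℝ} (hG : G = jacobian g β₀) (hGrank : G.rank = q)
    (hnull : g β₀ = 0) {a b : ℕ → Vec p} {l : ℕ → Vec q}
    (ha : ∀ n, IsUnconstrainedEstimator (Q n) Bset (a n))
    (hb : ∀ n, IsConstrainedEstimator (Q n) g Bset (l n) (b n))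
    (hl : ∀ n, IsLagrangeMultiplier (Q n) g (b n) (l n))
    {z : ℕ → Vec p} (hz : z = fun n => score (Q n) β₀) :
    Aᵀ = A ∧ IsUnit (matS G A).det ∧
    (fun n => l n - mv ((matS G A)⁻¹ * -(G * A⁻¹)) (z n)) =o[atTop] z ∧
    (fun n => g (a n) - mv (-(G * A⁻¹)) (z n)) =o[atTop] z ∧
    (fun n => mv G (a n - b n) - mv (-(G * A⁻¹)) (z n)) =o[atTop] z ∧
    (fun n => score (Q n) (b n) - mv Gᵀ (l n)) =o[atTop] z ∧
    (fun n => a n - b n) =O[atTop] z := by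
  have hβ₀B : β₀ ∈ Bset := interior_subset hβ₀
  have hat : Tendsto a atTop (𝓝 β₀) :=
    tendsto_of_uniform_limit_of_unique_max hBset hβ₀B hQcont hQlim hident (fun n => (ha n).1)
      fun n => (ha n).2 hβ₀B
  have hbt : Tendsto b atTop (𝓝 β₀) :=
    tendsto_of_uniform_limit_of_unique_max hBset hβ₀B hQcont hQlim hident (fun n => (hb n).1.1)
      fun n => (hb n).le hβ₀B hnull
  have hint : ∀ᶠ β in 𝓝 β₀, Bset ∈ 𝓝 β :=
    (eventually_mem_nhds_iff.2 (mem_interior_iff_mem_nhds.1 hβ₀))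
  have hmax : ∀ᶠ n in atTop, IsLocalMax (Q n) (a n) := by
    filter_upwards [hat.eventually hint] with n hn
    exact (ha n).2.isLocalMax hn
  have hAs : Aᵀ = A := hA ▸ transpose_eq_of_tendsto_hessian hV hβ₀V hQ hAlim
  have hneg : ∀ v, inner ℝ (mv A v) v ≤ 0 :=
    hA ▸ inner_limit_hessian_nonpos hV hβ₀V hQ hAlim hat hmax
  have hS : IsUnit (matS G A).det := isUnit_det_matS hAinv hAs hneg hGrank
  have ea : (fun n => -z n - mv A (a n - β₀)) =o[atTop] fun n => a n - β₀ := by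
    refine (score_expansion hV hβ₀V hQ hAlim hat).congr' ?_ EventuallyEq.rfl
    filter_upwards [hmax] with n hn
    rw [score_eq_zero_of_isLocalMax hn, hz, hA, zero_sub]
  have eb : (fun n => score (Q n) (b n) - z n - mv A (b n - β₀)) =o[atTop] fun n => b n - β₀ := by
    rw [hA, hz]
    exact score_expansion hV hβ₀V hQ hAlim hbt
  have hgd : HasFDerivAt g (mv G) β₀ := by
    rw [hG, mv_jacobian]
    exact (hg.differentiable (by norm_num) β₀).hasFDerivAt
  have hgx {x : ℕ → Vec p} (hx : Tendsto x atTop (𝓝 β₀)) :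
      (fun n => g (x n) - mv G (x n - β₀)) =o[atTop] fun n => x n - β₀ := by
    simpa [hnull, Function.comp_def] using hgd.isLittleO.comp_tendsto hx
  -- Both `btil` and `β₀` satisfy the restriction, so the linear part of `g` is itself a remainder.
  have hGb : (fun n => mv G (b n - β₀)) =o[atTop] fun n => b n - β₀ := by
    refine (hgx hbt).neg_left.congr_left fun n => ?_
    rw [(hb n).1.2, zero_sub, neg_neg]
  have hfoc : ∀ᶠ n in atTop, score (Q n) (b n) = mv (jacobian g (b n))ᵀ (l n) := by
    filter_upwards [hbt.eventually hint, hbt.eventually (hV.mem_nhds hβ₀V),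
      hbt.eventually (eventually_surjective_fderiv hg (hG ▸ hGrank))] with n h1 h2 h3
    exact score_eq_of_isLagrangeMultiplier
      (((hQ n).contDiffAt (hV.mem_nhds h2)).of_le (by norm_num)) hg.contDiffAt h3 h1 (hb n) (hl n)
  -- Freezing the Jacobian at `β₀` costs `o(1)` times `‖l‖`; a bound on `l` comes only from solving
  -- the system.
  have el : (fun n => score (Q n) (b n) - mv Gᵀ (l n)) =o[atTop] l := by
    have hJ : Tendsto (fun n => mv (jacobian g (b n))ᵀ - mv Gᵀ) atTop (𝓝 0) := by
      have h1 : Continuous fun β => mv (jacobian g β)ᵀ - mv Gᵀ :=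
        (continuous_mv.comp (continuous_jacobian hg).matrix_transpose).sub continuous_const
      have h2 := (h1.tendsto β₀).comp hbt
      rw [← hG, sub_self] at h2
      exact h2
    have h0 : (fun n => mv (jacobian g (b n))ᵀ - mv Gᵀ) =o[atTop] fun _ => (1 : ℝ) :=
      (isLittleO_one_iff ℝ).2 hJ
    have h1 : (fun n => (mv (jacobian g (b n))ᵀ - mv Gᵀ) (l n)) =o[atTop] l := by
      have h2 : (fun n => ‖mv (jacobian g (b n))ᵀ - mv Gᵀ‖ * ‖l n‖) =o[atTop]
          fun n => (1 : ℝ) * ‖l n‖ := h0.norm_left.mul_isBigO (isBigO_refl _ _)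
      simp only [one_mul] at h2
      refine IsLittleO.of_norm_right ((isBigO_of_le _ fun n => ?_).trans_isLittleO h2)
      simpa using (mv (jacobian g (b n))ᵀ - mv Gᵀ).le_opNorm (l n)
    refine h1.congr' ?_ EventuallyEq.rfl
    filter_upwards [hfoc] with n hn
    rw [hn, _root_.sub_apply]
  obtain ⟨ha1, ha2⟩ := unconstrained_expansion hAinv ea
  obtain ⟨hl1, hd2, hl2⟩ := constrained_expansion hAinv hS eb hGb el
  have hGa : (fun n => mv G (a n - β₀) - mv (-(G * A⁻¹)) (z n)) =o[atTop] z := by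
    have := isLittleO_mv_comp ha1 G
    rwa [Matrix.mul_neg] at this
  refine ⟨hAs, hS, ?_, ?_, ?_, el.trans_isBigO hl2, ?_⟩
  · rwa [Matrix.mul_neg]
  · refine (((hgx hat).trans_isBigO ha2).add hGa).congr_left fun n => ?_
    abel
  · refine (hGa.sub (hGb.trans_isBigO hd2)).congr_left fun n => ?_
    rw [← sub_sub_sub_cancel_right (a n) (b n) β₀, map_sub (mv G) (a n - β₀)]
    abel
  · refine (ha2.sub hd2).congr_left fun n => ?_
    abel

/-- Errors of the bilinear form statistics relative to the Wald quadratic form. -/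
lemma isLittleO_statistics {p q : ℕ} {A B : Matrix (Fin p) (Fin p) ℝ}
    {G : Matrix (Fin q) (Fin p) ℝ} (hGrank : G.rank = q) (hAinv : IsUnit A.det)
    (hAs : Aᵀ = A) (hS : IsUnit (matS G A).det) {z s a b : ℕ → Vec p} {l γ : ℕ → Vec q}
    (hl : (fun n => l n - mv ((matS G A)⁻¹ * -(G * A⁻¹)) (z n)) =o[atTop] z)
    (hγ : (fun n => γ n - mv (-(G * A⁻¹)) (z n)) =o[atTop] z)
    (hG : (fun n => mv G (a n - b n) - mv (-(G * A⁻¹)) (z n)) =o[atTop] z)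
    (hs : (fun n => s n - mv Gᵀ (l n)) =o[atTop] z)
    (hab : (fun n => a n - b n) =O[atTop] z) {f : Vec p → ℝ}
    (hf : f = fun z => inner ℝ z (mv ((G * A⁻¹)ᵀ * (matOmega G A B)⁻¹ * (G * A⁻¹)) z)) :
    ((fun n => BF1 n G A B (l n) (γ n) - f (√(n : ℝ) • z n)) =o[atTop]
      fun n => ‖√(n : ℝ) • z n‖ ^ 2) ∧
    ((fun n => BF2 n G A B (γ n) (s n) - f (√(n : ℝ) • z n)) =o[atTop]
      fun n => ‖√(n : ℝ) • z n‖ ^ 2) ∧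
    ((fun n => BF3 n G A B (s n) (a n) (b n) - f (√(n : ℝ) • z n)) =o[atTop]
      fun n => ‖√(n : ℝ) • z n‖ ^ 2) ∧
    (B = -A → (fun n => BF7 n (s n) (a n) (b n) - f (√(n : ℝ) • z n)) =o[atTop]
      fun n => ‖√(n : ℝ) • z n‖ ^ 2) := by
  subst hf
  set S := matS G A
  set O := matOmega G A B with hOdef
  set C := G * A⁻¹
  have hSt : Sᵀ = S := matS_transpose hAinv hAs
  -- Symmetry of `S` lets the `S⁻¹` of the multiplier cancel the weight `S`; in `hK2`, `G G⁺ = 1`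
  -- reduces the score to the multiplier.
  have hK1 : (S⁻¹ * -C)ᵀ * (S * O⁻¹ * -C) = Cᵀ * O⁻¹ * C := by
    have : Cᵀ * S⁻¹ * (S * O⁻¹ * C) = Cᵀ * (S⁻¹ * S) * O⁻¹ * C := by simp only [Matrix.mul_assoc]
    rw [Matrix.transpose_mul, Matrix.transpose_nonsing_inv, hSt, Matrix.transpose_neg,
      Matrix.neg_mul, Matrix.mul_neg, Matrix.neg_mul, Matrix.mul_neg, neg_neg, this,
      Matrix.nonsing_inv_mul _ hS, Matrix.mul_one]
  have hK2 : (Gᵀ * (S⁻¹ * -C))ᵀ * (pinv G * S * O⁻¹ * -C) = Cᵀ * O⁻¹ * C := by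
    rw [← hK1, Matrix.transpose_mul Gᵀ, Matrix.transpose_transpose]
    have : (S⁻¹ * -C)ᵀ * G * (pinv G * S * O⁻¹ * -C) =
        (S⁻¹ * -C)ᵀ * (G * pinv G) * (S * O⁻¹ * -C) := by simp only [Matrix.mul_assoc]
    rw [this, mul_pinv hGrank, Matrix.mul_one]
  have hs' : (fun n => s n - mv (Gᵀ * (S⁻¹ * -C)) (z n)) =o[atTop] z := by
    refine (hs.add (isLittleO_mv_comp hl Gᵀ)).congr_left fun n => ?_
    abel
  refine ⟨?_, ?_, ?_, fun hBA => ?_⟩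
  · refine (isLittleO_bilinear_statistic hl (isLittleO_mv_comp hγ (S * O⁻¹)) hK1).congr_left
      fun n => ?_
    rw [inner_eq_dotProduct, BF1, ofLp_mv]
  · refine (isLittleO_bilinear_statistic hs' (isLittleO_mv_comp hγ (pinv G * S * O⁻¹))
      hK2).congr_left fun n => ?_
    rw [inner_eq_dotProduct, BF2, ofLp_mv]
  · refine (isLittleO_bilinear_statistic hs' (isLittleO_mv_comp hG (pinv G * S * O⁻¹))
      hK2).congr_left fun n => ?_
    rw [← mv_mul, inner_eq_dotProduct (s n), BF3, ofLp_mv]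
  · have hOS : O = S := by rw [hOdef, hBA, matOmega_neg hAinv]
    have hK3 : (S⁻¹ * -C)ᵀ * -C = Cᵀ * O⁻¹ * C := by
      rw [← hK1, hOS, Matrix.mul_nonsing_inv _ hS, Matrix.one_mul]
    have h1 := isLittleO_bilinear_statistic hl hG hK3
    -- Split `s = Gᵀ l + (s - Gᵀ l)`: the first part pairs with `G (a - b)`, the second contributes
    -- `o(z) · O(z)`.
    have h2 : (fun n => inner ℝ (s n - mv Gᵀ (l n)) (a n - b n)) =o[atTop] fun n => ‖z n‖ ^ 2 := by
      simp only [pow_two]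
      exact (isBigO_of_le _ fun n => by
        simpa using norm_inner_le_norm (𝕜 := ℝ) (s n - mv Gᵀ (l n)) (a n - b n)).trans_isLittleO
        (hs.norm_norm.mul_isBigO hab.norm_norm)
    refine (h1.add (isLittleO_scale h2)).congr_left fun n => ?_
    rw [inner_sub_left, inner_mv_left Gᵀ, Matrix.transpose_transpose, BF7,
      ← inner_eq_dotProduct (s n)]
    ring

end

end ExtremumTest

theorem proposition1 {p q : ℕ} {Ω : Type*} [MeasurableSpace Ω] (P : Measure Ω)
    [IsProbabilityMeasure P]
    -- the random objective functions: `Q n ω β` is the value at `β` for the first `n` data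
    (Q : ℕ → Ω → Vec p → ℝ)
    -- the compact parameter set and the true parameter, an interior point of it
    (Bset : Set (Vec p)) (hBset : IsCompact Bset)
    (β₀ : Vec p) (hβ₀ : β₀ ∈ interior Bset)
    -- continuity, uniform almost sure convergence, and identification
    (hQcont : ∀ n, ∀ᵐ ω ∂P, ContinuousOn (Q n ω) Bset)
    (Qlim : Vec p → ℝ)
    (hQlim : ∀ᵐ ω ∂P, TendstoUniformlyOn (fun n => Q n ω) Qlim atTop Bset)
    (hident : ∀ β ∈ Bset, β ≠ β₀ → Qlim β < Qlim β₀)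
    -- smoothness near the true parameter, and uniform almost sure convergence of the Hessians
    (V : Set (Vec p)) (hVopen : IsOpen V) (hβ₀V : β₀ ∈ V)
    (hQsmooth : ∀ n, ∀ᵐ ω ∂P, ContDiffOn ℝ 2 (Q n ω) V)
    (Alim : Vec p → Matrix (Fin p) (Fin p) ℝ)
    (hAlim : ∀ᵐ ω ∂P, ∀ i j,
      TendstoUniformlyOn (fun n β => hessian (Q n ω) β i j) (fun β => Alim β i j) atTop V)
    (A : Matrix (Fin p) (Fin p) ℝ) (hA : A = Alim β₀) (hAinv : IsUnit A.det)
    -- asymptotic normality of the score at the true parameter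
    (B : Matrix (Fin p) (Fin p) ℝ) (hB : B.PosSemidef)
    (hscore : ConvergesInLaw P (fun n ω => √(n : ℝ) • score (Q n ω) β₀) (multivariateGaussian 0 B))
    -- the restriction, its Jacobian at the true parameter, and the null hypothesis
    (g : Vec p → Vec q) (hg : ContDiff ℝ 1 g)
    (G : Matrix (Fin q) (Fin p) ℝ) (hG : G = jacobian g β₀) (hGrank : G.rank = q)
    (hΩ : IsUnit (matOmega G A B).det)
    (hnull : g β₀ = 0)
    -- the estimators and the Lagrange multiplier
    (bhat btil : ℕ → Ω → Vec p) (lam : ℕ → Ω → Vec q)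
    (hbhat : ∀ n, ∀ᵐ ω ∂P, IsUnconstrainedEstimator (Q n ω) Bset (bhat n ω))
    (hbtil : ∀ n, ∀ᵐ ω ∂P, IsConstrainedEstimator (Q n ω) g Bset (lam n ω) (btil n ω))
    (hlam : ∀ n, ∀ᵐ ω ∂P, IsLagrangeMultiplier (Q n ω) g (btil n ω) (lam n ω))
    -- the quantities in the statistics are random variables
    (hbhat_meas : ∀ n, AEMeasurable (bhat n) P)
    (hbtil_meas : ∀ n, AEMeasurable (btil n) P)
    (hlam_meas : ∀ n, AEMeasurable (lam n) P)
    (hscore_meas : ∀ n, AEMeasurable (fun ω => score (Q n ω) (btil n ω)) P) :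
    (ConvergesInLaw P (fun n ω => BF1 n G A B (lam n ω) (g (bhat n ω))) (chiSquare q) ∧
      ConvergesInLaw P
        (fun n ω => BF2 n G A B (g (bhat n ω)) (score (Q n ω) (btil n ω))) (chiSquare q) ∧
      ConvergesInLaw P
        (fun n ω => BF3 n G A B (score (Q n ω) (btil n ω)) (bhat n ω) (btil n ω))
        (chiSquare q)) ∧
    (B = -A →
      ConvergesInLaw P (fun n ω => BF4 n (lam n ω) (g (bhat n ω))) (chiSquare q) ∧
      ConvergesInLaw P
        (fun n ω => BF5 n G (g (bhat n ω)) (score (Q n ω) (btil n ω))) (chiSquare q) ∧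
      ConvergesInLaw P
        (fun n ω => BF6 n G (score (Q n ω) (btil n ω)) (bhat n ω) (btil n ω)) (chiSquare q) ∧
      ConvergesInLaw P
        (fun n ω => BF7 n (score (Q n ω) (btil n ω)) (bhat n ω) (btil n ω)) (chiSquare q)) := by
  have hAE := ((ae_all_iff.2 hQcont).and <| hQlim.and <| (ae_all_iff.2 hQsmooth).and <|
    hAlim.and <| (ae_all_iff.2 hbhat).and <| (ae_all_iff.2 hbtil).and (ae_all_iff.2 hlam)).mono
    fun ω h => pathwise_expansions hBset hβ₀ h.1 h.2.1 hident hVopen hβ₀V h.2.2.1 h.2.2.2.1 hA hAinv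
      hg hG hGrank hnull h.2.2.2.2.1 h.2.2.2.2.2.1 h.2.2.2.2.2.2 rfl
  -- Symmetry of `A` and invertibility of `S` are nonrandom, so a single good path proves them.
  obtain ⟨ω₀, hAs, hS, -⟩ := hAE.exists
  have hstat := hAE.mono fun ω h => isLittleO_statistics (B := B) hGrank hAinv hAs hS
    h.2.2.1 h.2.2.2.1 h.2.2.2.2.1 h.2.2.2.2.2.1 h.2.2.2.2.2.2 rfl
  have hOmega : matOmega G A B = G * A⁻¹ * B * (G * A⁻¹)ᵀ := by
    rw [matOmega, Matrix.transpose_mul, Matrix.transpose_nonsing_inv, hAs]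
    simp only [Matrix.mul_assoc]
  have hlaw : (multivariateGaussian 0 B).map
      (fun z => inner ℝ z (mv ((G * A⁻¹)ᵀ * (matOmega G A B)⁻¹ * (G * A⁻¹)) z)) = chiSquare q := by
    rw [hOmega] at hΩ ⊢
    exact map_wald_multivariateGaussian hB hΩ
  have hghat_meas : ∀ n, AEMeasurable (fun ω => g (bhat n ω)) P := fun n =>
    hg.continuous.measurable.comp_aemeasurable (hbhat_meas n)
  have hlim {Y : ℕ → Ω → ℝ} (hY : ∀ n, AEMeasurable (Y n) P) :=
    convergesInLaw_of_isLittleO hscore hY (by fun_prop) hlaw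
  have hbilin {m : ℕ} {x y : Ω → Vec m} (hx : AEMeasurable x P) (hy : AEMeasurable y P) (n : ℕ) :
      AEMeasurable (fun ω => n * ((x ω).ofLp ⬝ᵥ (y ω).ofLp)) P := by
    simp only [← inner_eq_dotProduct]
    exact (hx.inner hy).const_mul _
  have hmv {m k : ℕ} (M : Matrix (Fin k) (Fin m) ℝ) {x : Ω → Vec m} (hx : AEMeasurable x P) :
      AEMeasurable (fun ω => mv M (x ω)) P := (mv M).measurable.comp_aemeasurable hx
  have H1 : ConvergesInLaw P (fun n ω => BF1 n G A B (lam n ω) (g (bhat n ω))) (chiSquare q) :=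
    hlim (fun n => hbilin (hlam_meas n) (hmv _ (hghat_meas n)) n) (hstat.mono fun ω h => h.1)
  have H2 : ConvergesInLaw P
      (fun n ω => BF2 n G A B (g (bhat n ω)) (score (Q n ω) (btil n ω))) (chiSquare q) :=
    hlim (fun n => hbilin (hscore_meas n) (hmv _ (hghat_meas n)) n) (hstat.mono fun ω h => h.2.1)
  have H3 : ConvergesInLaw P
      (fun n ω => BF3 n G A B (score (Q n ω) (btil n ω)) (bhat n ω) (btil n ω)) (chiSquare q) :=
    hlim (fun n => hbilin (hscore_meas n) (hmv _ ((hbhat_meas n).sub (hbtil_meas n))) n)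
      (hstat.mono fun ω h => h.2.2.1)
  refine ⟨⟨H1, H2, H3⟩, fun hBA => ?_⟩
  -- When `B = -A`, `Ω = S`, so `BF4`, `BF5`, `BF6` coincide with `BF1`, `BF2`, `BF3`; only `BF7`
  -- needs its own expansion.
  have hSO : matS G A * (matOmega G A B)⁻¹ = 1 := by
    rw [hBA, matOmega_neg hAinv, Matrix.mul_nonsing_inv _ hS]
  refine ⟨?_, ?_, ?_, ?_⟩
  · simpa only [BF1, BF4, hSO, Matrix.one_mulVec] using H1
  · simpa only [BF2, BF5, Matrix.mul_assoc, hSO, Matrix.mul_one] using H2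
  · simpa only [BF3, BF6, matP, Matrix.mul_assoc (pinv G), hSO, Matrix.mul_one] using H3
  · exact hlim (fun n => hbilin (hscore_meas n) ((hbhat_meas n).sub (hbtil_meas n)) n)
      (hstat.mono fun ω h => h.2.2.2 hBA)
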